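/- Recall the following notions. A Gromov-hyperbolic space is a geodesic metric space $X$ for which there is $\delta\ge 0$ such that every side of every geodesic triangle lies in the $\delta$-neighbourhood of the union of the other two sides. Write $(x\cdot y)_{o}=\frac12\big(d(o,x)+d(o,y)-d(x,y)\big)$. The Gromov boundary $\partial X$ is the set of sequences $(x_n)$ in $X$ with $(x_i\cdot x_j)_{o}\to\infty$ as $i,j\to\infty$, modulo the relation $(x_n)\sim(y_n)$ iff $(x_i\cdot y_j)_{o}\to\infty$ as $i,j\to\infty$ (these notions do not depend on the base point $o\in X$). A group $G$ acting on $X$ by isometries acts on $\partial X$ by $g\cdot[(x_n)]=[(g x_n)]$, and its limit set $\Lambda(G)\subseteq\partial X$ is the set of boundary points represented by a sequence $(g_n o)$ with $g_n\in G$. The action is lineal if $|\Lambda(G)|=2$, and focal if $\Lambda(G)$ is infinite and $G$ fixes a point of $\partial X$. An element $g\in G$ is hyperbolic on $X$ if the orbits of $\langle g\rangle$ in $X$ are unbounded and $g$ has exactly two fixed points in $\partial X$. **Proposition.** Let $G$ be a group acting by isometries on finitely many Gromov-hyperbolic spaces $X_1,\dots,X_l$ such that, for each $i$, the action of $G$ on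 $X_i$ is lineal or focal. Then there is an element $g\in G$ that is hyperbolic on $X_i$ for every $1\le i\le l$; that is, $$\mathcal{SH}(G)=\{g\in G: g\text{ is hyperbolic on each }X_i,\ 1\le i\le l\}\neq\varnothing .$$ -/

import Mathlib

open Filter Set

/-- `s` is (the image of) a geodesic segment from `x` to `y`: the image of an isometric embedding
of an interval `[0, L]` which sends `0` to `x` and `L` to `y`. -/
def IsGeodesicSegment {X : Type*} [MetricSpace X] (x y : X) (s : Set X) : Prop :=
  ∃ (L : ℝ) (γ : ℝ → X), 0 ≤ L ∧ γ 0 = x ∧ γ L = y ∧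
    (∀ a ∈ Icc (0 : ℝ) L, ∀ b ∈ Icc (0 : ℝ) L, dist (γ a) (γ b) = |a - b|) ∧
    s = γ '' Icc (0 : ℝ) L

/-- Any two points can be connected by a geodesic. -/
def IsGeodesicSpace (X : Type*) [MetricSpace X] : Prop :=
  ∀ x y : X, ∃ s : Set X, IsGeodesicSegment x y s

/-- Every geodesic triangle is `δ`-thin: each side lies in the `δ`-neighbourhood of the union of
the two others. (All vertices are quantified over and segments can be reversed, so that it is
enough to mention one of the sides.) -/
def HasThinTriangles (X : Type*) [MetricSpace X] (δ : ℝ) : Prop :=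
  ∀ (x y z : X) (a b c : Set X),
    IsGeodesicSegment x y a → IsGeodesicSegment y z b → IsGeodesicSegment z x c →
      ∀ p ∈ a, ∃ q ∈ b ∪ c, dist p q ≤ δ

/-- Gromov-hyperbolic spaces: geodesic metric spaces with `δ`-thin triangles for some `δ ≥ 0`. -/
def IsGromovHyperbolic (X : Type*) [MetricSpace X] : Prop :=
  IsGeodesicSpace X ∧ ∃ δ : ℝ, 0 ≤ δ ∧ HasThinTriangles X δ

/-- The Gromov product `(x · y)_o`. -/
noncomputable def gromovProduct {X : Type*} [MetricSpace X] (o x y : X) : ℝ :=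
  (dist o x + dist o y - dist x y) / 2

/-- `(x_i · y_j)_o → ∞` as `i, j → ∞`. Changing the base point changes Gromov products by a
bounded amount, so this does not depend on `o`, and all base points are allowed. -/
def GromovEquiv {X : Type*} [MetricSpace X] (x y : ℕ → X) : Prop :=
  ∀ o : X, Tendsto (fun p : ℕ × ℕ => gromovProduct o (x p.1) (y p.2)) atTop atTop

/-- The sequence `x` converges at infinity: `(x_i · x_j)_o → ∞` as `i, j → ∞`. -/
def ConvergesAtInfinity {X : Type*} [MetricSpace X] (x : ℕ → X) : Prop :=
  GromovEquiv x x

/-- The Gromov boundary `∂X`: sequences converging at infinity, modulo `GromovEquiv` (which is an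
equivalence relation on such sequences when `X` is Gromov-hyperbolic). -/
def GromovBoundary (X : Type*) [MetricSpace X] : Type _ :=
  Quot fun x y : {u : ℕ → X // ConvergesAtInfinity u} => GromovEquiv x.1 y.1

theorem gromovProduct_smul {G X : Type*} [Group G] [MetricSpace X] [MulAction G X]
    [IsIsometricSMul G X] (g : G) (o x y : X) :
    gromovProduct o (g • x) (g • y) = gromovProduct (g⁻¹ • o) x y := by
  have h : ∀ z : X, dist o (g • z) = dist (g⁻¹ • o) z := fun z => by
    rw [← dist_smul g (g⁻¹ • o) z, smul_inv_smul]
  simp only [gromovProduct, h, dist_smul]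

theorem GromovEquiv.smul {G X : Type*} [Group G] [MetricSpace X] [MulAction G X]
    [IsIsometricSMul G X] (g : G) {x y : ℕ → X} (h : GromovEquiv x y) :
    GromovEquiv (fun n => g • x n) (fun n => g • y n) := fun o => by
  simpa only [gromovProduct_smul] using h (g⁻¹ • o)

/-- The action `g • [(x_n)] = [(g • x_n)]` on the Gromov boundary induced by an isometric
action. -/
instance GromovBoundary.instMulAction {G X : Type*} [Group G] [MetricSpace X] [MulAction G X]
    [IsIsometricSMul G X] : MulAction G (GromovBoundary X) where
  smul g := Quot.map (fun x => ⟨fun n => g • x.1 n, GromovEquiv.smul g x.2⟩)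
    fun _ _ h => GromovEquiv.smul g h
  one_smul ξ := by
    induction ξ using Quot.ind with
    | _ x => exact congrArg (Quot.mk _) (Subtype.ext (funext fun n => one_smul G (x.1 n)))
  mul_smul g h ξ := by
    induction ξ using Quot.ind with
    | _ x => exact congrArg (Quot.mk _) (Subtype.ext (funext fun n => mul_smul g h (x.1 n)))

/-- The limit set `Λ(G) ⊆ ∂X`: the boundary points represented by a sequence in an orbit of `G`.
(Two orbits of `G` have the same limit points, so the base point `o` does not matter.) -/
def limitSet (G X : Type*) [Group G] [MetricSpace X] [MulAction G X] :
    Set (GromovBoundary X) :=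
  {ξ | ∃ (o : X) (u : ℕ → G) (h : ConvergesAtInfinity fun n => u n • o),
    ξ = Quot.mk _ ⟨fun n => u n • o, h⟩}

/-- `g` is elliptic on `X`: the orbits of the cyclic group generated by `g` are bounded. -/
def IsEllipticElement {G : Type*} (X : Type*) [Group G] [MetricSpace X] [MulAction G X]
    (g : G) : Prop :=
  ∀ x : X, Bornology.IsBounded (MulAction.orbit (Subgroup.zpowers g) x)

/-- `g` is hyperbolic on `X`: it is not elliptic and has exactly two fixed points in `∂X`. -/
def IsHyperbolicElement {G : Type*} (X : Type*) [Group G] [MetricSpace X] [MulAction G X]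
    [IsIsometricSMul G X] (g : G) : Prop :=
  ¬ IsEllipticElement X g ∧ (MulAction.fixedBy (GromovBoundary X) g).encard = 2

/-- The action of `G` on `X` is lineal: `|Λ(G)| = 2`. -/
def IsLinealAction (G X : Type*) [Group G] [MetricSpace X] [MulAction G X] : Prop :=
  (limitSet G X).encard = 2

/-- The action of `G` on `X` is focal (quasi-parabolic): `|Λ(G)| = ∞` and `G` fixes a point of
`∂X`. -/
def IsFocalAction (G X : Type*) [Group G] [MetricSpace X] [MulAction G X]
    [IsIsometricSMul G X] : Prop :=
  (limitSet G X).Infinite ∧ (MulAction.fixedPoints G (GromovBoundary X)).Nonempty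

/-- `SH(G)`: the elements of `G` that are hyperbolic on every `X i`. -/
def simultaneouslyHyperbolic (G : Type*) {ι : Type*} (X : ι → Type*) [Group G]
    [∀ i, MetricSpace (X i)] [∀ i, MulAction G (X i)] [∀ i, IsIsometricSMul G (X i)] : Set G :=
  {g | ∀ i, IsHyperbolicElement (X i) g}

/-! The differences `d(x, w_n) - d(o, w_n)`, for `w` converging to a boundary point `ξ`, converge up
to a bounded error to a Busemann function `b` of `ξ`, and `g ↦ b (g o)` is a quasimorphism on the
stabilizer of `ξ`. By the four-point condition with `ξ` as one of the points, `d(o, gⁿ o)` differs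
from `b (gⁿ o)` by a bounded amount once `b (g o)` is large. The displacement of `gⁿ` is then
additive up to a bounded error, so `g` is hyperbolic with its two fixed points the limits of the
sequences `gⁿ o` and `g⁻ⁿ o`.

In a lineal or focal action some `ξ` has a finite orbit and is not the only limit point. Along a
sequence of orbit points converging to another limit point `b` tends to infinity, so the
quasimorphism is unbounded on every subgroup of finite index in the stabilizer of `ξ`, in particular
on the intersection `H` of these stabilizers over the finitely many spaces. Finally, finitely many
unbounded quasimorphisms on `H` are simultaneously large at some element: if all but one of them
are large at `g` and the last one is bounded on the powers of `g` but large at `h`, take `gⁿ h` with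
`n` large. -/

/-- `β` is a quasimorphism of defect at most `D`: it is a homomorphism up to the error `D`. -/
def IsQuasimorphism {H : Type*} [Monoid H] (β : H → ℝ) (D : ℝ) : Prop :=
  ∀ g h, |β (g * h) - β g - β h| ≤ D

namespace IsQuasimorphism

section Monoid

variable {H : Type*} [Monoid H] {β : H → ℝ} {D : ℝ} {g : H}

theorem abs_map_one_le (hβ : IsQuasimorphism β D) : |β 1| ≤ D := by
  simpa using hβ 1 1

theorem neg (hβ : IsQuasimorphism β D) : IsQuasimorphism (fun g => -β g) D := fun g h => by
  rw [← abs_neg]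
  convert hβ g h using 2
  ring

theorem mono {D' : ℝ} (hβ : IsQuasimorphism β D) (hD : D ≤ D') : IsQuasimorphism β D' :=
  fun g h => (hβ g h).trans hD

theorem comp {K : Type*} [Monoid K] (hβ : IsQuasimorphism β D) (f : K →* H) :
    IsQuasimorphism (β ∘ f) D := fun g h => by
  simpa using hβ (f g) (f h)

theorem abs_map_left_le (hβ : IsQuasimorphism β D) (g h : H) :
    |β g| ≤ |β (g * h)| + |β h| + D := by
  have := hβ g h
  grind

theorem abs_map_right_le (hβ : IsQuasimorphism β D) (g h : H) :
    |β h| ≤ |β (g * h)| + |β g| + D := by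
  have := hβ g h
  grind

theorem abs_map_pow_sub_le (hβ : IsQuasimorphism β D) (g : H) (n : ℕ) :
    |β (g ^ n) - n * β g| ≤ (n + 1) * D := by
  induction n with
  | zero => simpa using hβ.abs_map_one_le
  | succ n ih =>
    have hmul := hβ (g ^ n) g
    rw [← pow_succ] at hmul
    rw [abs_le] at *
    push_cast
    constructor <;> linarith

theorem tendsto_map_pow_atTop (hβ : IsQuasimorphism β D) (hg : D < β g) :
    Tendsto (fun n : ℕ => β (g ^ n)) atTop atTop := by
  have hlow (n : ℕ) : n * (β g - D) + -D ≤ β (g ^ n) := by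
    linarith [(abs_le.1 (hβ.abs_map_pow_sub_le g n)).1]
  exact tendsto_atTop_mono hlow <| tendsto_atTop_add_const_right _ _ <|
    tendsto_natCast_atTop_atTop.atTop_mul_const (sub_pos.2 hg)

theorem tendsto_abs_map_pow_atTop (hβ : IsQuasimorphism β D) (hg : D < |β g|) :
    Tendsto (fun n : ℕ => |β (g ^ n)|) atTop atTop := by
  rcases lt_abs.1 hg with hg | hg
  · exact tendsto_abs_atTop_atTop.comp (hβ.tendsto_map_pow_atTop hg)
  · simpa [Function.comp_def] using tendsto_abs_atTop_atTop.comp (hβ.neg.tendsto_map_pow_atTop hg)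

theorem tendsto_abs_map_pow_atTop_of_pow (hβ : IsQuasimorphism β D) {p : ℕ}
    (hp : D < |β (g ^ p)|) : Tendsto (fun n : ℕ => |β (g ^ n)|) atTop atTop := by
  have hp0 : p ≠ 0 := by
    rintro rfl
    exact hp.not_ge (by simpa using hβ.abs_map_one_le)
  obtain ⟨R, hR⟩ := Finite.exists_le fun r : Fin p => |β (g ^ (r : ℕ))|
  have hlow (n : ℕ) : |β ((g ^ p) ^ (n / p))| + -(R + D) ≤ |β (g ^ n)| := by
    have hdiv := hβ.abs_map_left_le ((g ^ p) ^ (n / p)) (g ^ (n % p))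
    rw [← pow_mul, ← pow_add, Nat.div_add_mod, pow_mul] at hdiv
    linarith [hR ⟨n % p, Nat.mod_lt n hp0.bot_lt⟩]
  exact tendsto_atTop_mono hlow <| tendsto_atTop_add_const_right _ _ <|
    (hβ.tendsto_abs_map_pow_atTop hp).comp (Nat.tendsto_div_const_atTop hp0)

end Monoid

theorem exists_forall_lt_abs {H ι : Type*} [Monoid H] [Finite ι] {β : ι → H → ℝ} {D : ι → ℝ}
    (hβ : ∀ i, IsQuasimorphism (β i) (D i)) (hunb : ∀ i M, ∃ h, M < |β i h|) :
    ∃ h, ∀ i, D i < |β i h| := by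
  classical
  have := Fintype.ofFinite ι
  suffices ∀ s : Finset ι, ∃ h, ∀ i ∈ s, D i < |β i h| by simpa using this Finset.univ
  intro s
  induction s using Finset.induction_on with
  | empty => exact ⟨1, by simp⟩
  | insert k s _ ih =>
    obtain ⟨g, hg⟩ := ih
    have hgs : ∀ i ∈ s, Tendsto (fun n : ℕ => |β i (g ^ n)|) atTop atTop := fun i hi =>
      (hβ i).tendsto_abs_map_pow_atTop (hg i hi)
    by_cases hgk : ∃ p : ℕ, D k < |β k (g ^ p)|
    · obtain ⟨p, hp⟩ := hgk
      have hlarge : ∀ i ∈ insert k s, ∀ᶠ n : ℕ in atTop, D i < |β i (g ^ n)| :=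
        (Finset.forall_mem_insert _ _ _).2
          ⟨((hβ k).tendsto_abs_map_pow_atTop_of_pow hp).eventually_gt_atTop _,
            fun i hi => (hgs i hi).eventually_gt_atTop _⟩
      obtain ⟨n, hn⟩ := ((Finset.eventually_all _).2 hlarge).exists
      exact ⟨g ^ n, hn⟩
    · -- `β k` is bounded on the powers of `g`, so if it is large at `h`, so it is at `g ^ n * h`.
      push Not at hgk
      obtain ⟨h, hh⟩ := hunb k (3 * D k)
      have hlarge : ∀ i ∈ s, ∀ᶠ n : ℕ in atTop, 2 * D i + |β i h| < |β i (g ^ n)| := fun i hi =>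
        (hgs i hi).eventually_gt_atTop _
      obtain ⟨n, hn⟩ := ((Finset.eventually_all _).2 hlarge).exists
      refine ⟨g ^ n * h, (Finset.forall_mem_insert _ _ _).2 ⟨?_, fun i hi => ?_⟩⟩
      · linarith [(hβ k).abs_map_right_le (g ^ n) h, hgk n]
      · linarith [(hβ i).abs_map_left_le (g ^ n) h, hn i hi]

end IsQuasimorphism

section FourPoint

variable {X : Type*} [MetricSpace X]

theorem gromovProduct_comm (o x y : X) : gromovProduct o x y = gromovProduct o y x := by
  simp only [gromovProduct, dist_comm x y, add_comm]

theorem gromovProduct_self (o x : X) : gromovProduct o x x = dist o x := by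
  simp [gromovProduct]

theorem gromovProduct_le_dist_left (o x y : X) : gromovProduct o x y ≤ dist o x := by
  unfold gromovProduct
  linarith [dist_triangle o x y]

theorem gromovProduct_le_add_dist (o o' x y : X) :
    gromovProduct o x y ≤ gromovProduct o' x y + dist o o' := by
  unfold gromovProduct
  linarith [dist_triangle o o' x, dist_triangle o o' y]

theorem gromovProduct_add_gromovProduct_left (o p x : X) :
    gromovProduct o p x + gromovProduct p o x = dist o p := by
  simp only [gromovProduct, dist_comm p o]
  ring

/-- Gromov's four-point condition `min ((x · y)_o) ((y · z)_o) ≤ (x · z)_o + δ`: hyperbolicity with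
constant `δ` in the form which makes sense in spaces that are not geodesic. -/
def IsDeltaHyperbolic (X : Type*) [MetricSpace X] (δ : ℝ) : Prop :=
  ∀ o x y z : X, min (gromovProduct o x y) (gromovProduct o y z) ≤ gromovProduct o x z + δ

namespace IsGeodesicSegment

variable {x y p : X} {s : Set X}

theorem left_mem (hs : IsGeodesicSegment x y s) : x ∈ s := by
  obtain ⟨L, γ, hL, rfl, rfl, -, rfl⟩ := hs
  exact mem_image_of_mem γ (left_mem_Icc.2 hL)

theorem right_mem (hs : IsGeodesicSegment x y s) : y ∈ s := by
  obtain ⟨L, γ, hL, rfl, rfl, -, rfl⟩ := hs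
  exact mem_image_of_mem γ (right_mem_Icc.2 hL)

theorem isPreconnected (hs : IsGeodesicSegment x y s) : IsPreconnected s := by
  obtain ⟨L, γ, -, -, -, hγ, rfl⟩ := hs
  have hlip : LipschitzOnWith 1 γ (Icc 0 L) := .of_dist_le_mul fun a ha b hb => by
    simp [hγ a ha b hb, Real.dist_eq]
  exact isPreconnected_Icc.image γ hlip.continuousOn

theorem dist_add_dist (hs : IsGeodesicSegment x y s) (hp : p ∈ s) :
    dist x p + dist p y = dist x y := by
  obtain ⟨L, γ, hL, rfl, rfl, hγ, rfl⟩ := hs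
  obtain ⟨t, ht, rfl⟩ := hp
  have h0 := left_mem_Icc.2 hL
  have hL' := right_mem_Icc.2 hL
  rw [hγ _ h0 _ ht, hγ _ ht _ hL', hγ _ h0 _ hL', abs_of_nonpos (by linarith [ht.1]),
    abs_of_nonpos (by linarith [ht.2]), abs_of_nonpos (by linarith)]
  ring

theorem gromovProduct_eq_zero (hs : IsGeodesicSegment x y s) (hp : p ∈ s) :
    gromovProduct p x y = 0 := by
  simp [gromovProduct, dist_comm p x, hs.dist_add_dist hp]

theorem gromovProduct_le_dist (hs : IsGeodesicSegment x y s) (hp : p ∈ s) (o : X) :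
    gromovProduct o x y ≤ dist o p := by
  simpa [hs.gromovProduct_eq_zero hp] using gromovProduct_le_add_dist o p x y

theorem gromovProduct_le_infDist (hs : IsGeodesicSegment x y s) (o : X) :
    gromovProduct o x y ≤ Metric.infDist o s :=
  (Metric.le_infDist ⟨x, hs.left_mem⟩).2 fun _ hp => hs.gromovProduct_le_dist hp o

theorem exists_infDist_le (hs : IsGeodesicSegment x y s) {b c : Set X} {δ : ℝ} (hy : y ∈ b)
    (hx : x ∈ c) (h : ∀ p ∈ s, ∃ q ∈ b ∪ c, dist p q ≤ δ) :
    ∃ p ∈ s, Metric.infDist p b ≤ δ ∧ Metric.infDist p c ≤ δ := by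
  have hδ : 0 ≤ δ := (h x hs.left_mem).elim fun _ hq => dist_nonneg.trans hq.2
  have hclosed (t : Set X) : IsClosed {p : X | Metric.infDist p t ≤ δ} :=
    isClosed_le (Metric.continuous_infDist_pt t) continuous_const
  have hcover : s ⊆ {p | Metric.infDist p b ≤ δ} ∪ {p | Metric.infDist p c ≤ δ} := fun p hp => by
    obtain ⟨q, hq, hpq⟩ := h p hp
    exact hq.imp (fun hq => (Metric.infDist_le_dist_of_mem hq).trans hpq)
      fun hq => (Metric.infDist_le_dist_of_mem hq).trans hpq
  exact isPreconnected_closed_iff.1 hs.isPreconnected _ _ (hclosed b) (hclosed c) hcover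
    ⟨y, hs.right_mem, (Metric.infDist_zero_of_mem hy).trans_le hδ⟩
    ⟨x, hs.left_mem, (Metric.infDist_zero_of_mem hx).trans_le hδ⟩

end IsGeodesicSegment

theorem HasThinTriangles.exists_mem_dist_le {δ : ℝ} (hthin : HasThinTriangles X δ)
    (hgeo : IsGeodesicSpace X) (o : X) {x y : X} {s : Set X} (hs : IsGeodesicSegment x y s) :
    ∃ p ∈ s, dist o p ≤ gromovProduct o x y + 2 * δ := by
  obtain ⟨b, hb⟩ := hgeo y o
  obtain ⟨c, hc⟩ := hgeo o x
  obtain ⟨p, hp, hpb, hpc⟩ := hs.exists_infDist_le hb.left_mem hc.right_mem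
    (hthin x y o s b c hs hb hc)
  have hyo := (hb.gromovProduct_le_infDist p).trans hpb
  have hox := (hc.gromovProduct_le_infDist p).trans hpc
  have hxy := hs.gromovProduct_eq_zero hp
  refine ⟨p, hp, ?_⟩
  simp only [gromovProduct, dist_comm p o, dist_comm y o] at *
  linarith

theorem HasThinTriangles.isDeltaHyperbolic {δ : ℝ} (hthin : HasThinTriangles X δ)
    (hgeo : IsGeodesicSpace X) : IsDeltaHyperbolic X (3 * δ) := by
  intro o x y z
  obtain ⟨a, ha⟩ := hgeo x z
  obtain ⟨b, hb⟩ := hgeo z y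
  obtain ⟨c, hc⟩ := hgeo y x
  obtain ⟨p, hp, hop⟩ := hthin.exists_mem_dist_le hgeo o ha
  obtain ⟨q, hq, hpq⟩ := hthin x z y a b c ha hb hc p hp
  have hoq : dist o q ≤ gromovProduct o x z + 3 * δ := by linarith [dist_triangle o p q]
  rcases hq with hq | hq
  · rw [gromovProduct_comm o y z]
    exact (min_le_right _ _).trans ((hb.gromovProduct_le_dist hq o).trans hoq)
  · rw [gromovProduct_comm o x y]
    exact (min_le_left _ _).trans ((hc.gromovProduct_le_dist hq o).trans hoq)

theorem IsGromovHyperbolic.exists_isDeltaHyperbolic (hX : IsGromovHyperbolic X) :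
    ∃ δ, IsDeltaHyperbolic X δ :=
  let ⟨hgeo, δ, _, hthin⟩ := hX
  ⟨3 * δ, hthin.isDeltaHyperbolic hgeo⟩

end FourPoint

section Boundary

variable {X : Type*} [MetricSpace X] {δ : ℝ} {x y z : ℕ → X}

theorem gromovEquiv_iff_tendsto (o : X) :
    GromovEquiv x y ↔
      Tendsto (fun p : ℕ × ℕ => gromovProduct o (x p.1) (y p.2)) (atTop ×ˢ atTop) atTop := by
  rw [prod_atTop_atTop_eq]
  refine ⟨fun h => h o, fun h o' => tendsto_atTop_mono (fun p => ?_)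
    (tendsto_atTop_add_const_right _ (-dist o o') h)⟩
  linarith [gromovProduct_le_add_dist o o' (x p.1) (y p.2)]

theorem gromovEquiv_iff_eventually (o : X) :
    GromovEquiv x y ↔
      ∀ M, ∀ᶠ N in atTop, ∀ i ≥ N, ∀ j ≥ N, M ≤ gromovProduct o (x i) (y j) := by
  rw [gromovEquiv_iff_tendsto o, prod_atTop_atTop_eq, tendsto_atTop]
  refine forall_congr' fun M => eventually_atTop_prod_self'.trans ?_
  rw [eventually_atTop]
  exact exists_congr fun N => ⟨fun h N' hN i hi j hj => h i (hN.trans hi) j (hN.trans hj),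
    fun h => h N le_rfl⟩

theorem GromovEquiv.symm (h : GromovEquiv x y) : GromovEquiv y x := fun o => by
  refine (gromovEquiv_iff_tendsto o).2 ?_ o
  simpa only [gromovProduct_comm o (x _), Function.comp_def, Prod.fst_swap, Prod.snd_swap]
    using ((gromovEquiv_iff_tendsto o).1 h).comp tendsto_prod_swap

theorem IsDeltaHyperbolic.nonneg (hδ : IsDeltaHyperbolic X δ) (o : X) : 0 ≤ δ := by
  simpa [gromovProduct_self] using hδ o o o o

theorem IsDeltaHyperbolic.le_gromovProduct (hδ : IsDeltaHyperbolic X δ) {o a b c : X} {M : ℝ}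
    (hab : M + δ ≤ gromovProduct o a b) (hbc : M + δ ≤ gromovProduct o b c) :
    M ≤ gromovProduct o a c := by
  linarith [hδ o a b c, le_min hab hbc]

theorem GromovEquiv.trans (hδ : IsDeltaHyperbolic X δ) (hxy : GromovEquiv x y)
    (hyz : GromovEquiv y z) : GromovEquiv x z := fun o => by
  refine (gromovEquiv_iff_eventually o).2 (fun M => ?_) o
  filter_upwards [(gromovEquiv_iff_eventually o).1 hxy (M + δ),
    (gromovEquiv_iff_eventually o).1 hyz (M + δ)] with N hxy hyz i hi j hj
  exact hδ.le_gromovProduct (hxy i hi N le_rfl) (hyz N le_rfl j hj)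

theorem GromovEquiv.comp_tendsto (h : GromovEquiv x y) {φ ψ : ℕ → ℕ} (hφ : Tendsto φ atTop atTop)
    (hψ : Tendsto ψ atTop atTop) : GromovEquiv (x ∘ φ) (y ∘ ψ) := fun o => by
  refine (gromovEquiv_iff_eventually o).2 (fun M => ?_) o
  obtain ⟨N, hN⟩ := ((gromovEquiv_iff_eventually o).1 h M).exists
  filter_upwards [eventually_forall_ge_atTop.2 (hφ.eventually_ge_atTop N),
    eventually_forall_ge_atTop.2 (hψ.eventually_ge_atTop N)] with k hφk hψk i hi j hj
  exact hN _ (hφk i hi) _ (hψk j hj)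

theorem GromovEquiv.tendsto_gromovProduct (h : GromovEquiv x y) (o : X) :
    Tendsto (fun n => gromovProduct o (x n) (y n)) atTop atTop :=
  (h o).comp tendsto_atTop_diagonal

theorem ConvergesAtInfinity.tendsto_dist (hx : ConvergesAtInfinity x) (o : X) :
    Tendsto (fun n => dist o (x n)) atTop atTop := by
  simpa only [gromovProduct_self] using GromovEquiv.tendsto_gromovProduct hx o

theorem convergesAtInfinity_of_le_gromovProduct_add (o : X) {f : ℕ → ℝ}
    (hf : Tendsto f atTop atTop) (h : ∀ n k, f n ≤ gromovProduct o (x n) (x (n + k))) :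
    ConvergesAtInfinity x := by
  refine (gromovEquiv_iff_eventually o).2 fun M => ?_
  filter_upwards [eventually_forall_ge_atTop.2 (hf.eventually_ge_atTop M)] with N hN i hi j hj
  rcases le_total i j with hij | hji
  · obtain ⟨k, rfl⟩ := Nat.exists_eq_add_of_le hij
    exact (hN i hi).trans (h i k)
  · obtain ⟨k, rfl⟩ := Nat.exists_eq_add_of_le hji
    rw [gromovProduct_comm]
    exact (hN j hj).trans (h j k)

/-- The inner index of the iterated limit can be moved because `y` converges at infinity. -/
theorem IsDeltaHyperbolic.gromovEquiv_of_eventually_frequently (hδ : IsDeltaHyperbolic X δ) (o : X)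
    (hy : ConvergesAtInfinity y)
    (h : ∀ M, ∀ᶠ i in atTop, ∃ᶠ j in atTop, M ≤ gromovProduct o (x i) (y j)) :
    GromovEquiv x y := by
  refine (gromovEquiv_iff_eventually o).2 fun M => ?_
  filter_upwards [eventually_forall_ge_atTop.2 (h (M + δ)),
    (gromovEquiv_iff_eventually o).1 hy (M + δ)] with N hxN hyN i hi j hj
  obtain ⟨k, hik, hk⟩ := ((hxN i hi).and_eventually (eventually_ge_atTop N)).exists
  exact hδ.le_gromovProduct hik (hyN k hk j hj)

theorem IsDeltaHyperbolic.exists_eventually_gromovProduct_le (hδ : IsDeltaHyperbolic X δ) (o : X)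
    (hx : ConvergesAtInfinity x) (hy : ConvergesAtInfinity y) (h : ¬ GromovEquiv x y) :
    ∃ K, ∀ᶠ i in atTop, ∀ᶠ j in atTop, gromovProduct o (x i) (y j) ≤ K := by
  by_contra! hfreq
  refine h (hδ.gromovEquiv_of_eventually_frequently o hy fun M => ?_)
  filter_upwards [(gromovEquiv_iff_eventually o).1 hx (M + δ)] with N hN
  obtain ⟨i, hi, hNi⟩ := ((hfreq (M + δ)).and_eventually (eventually_ge_atTop N)).exists
  exact hi.mono fun j hj => hδ.le_gromovProduct (hN N le_rfl i hNi) hj.le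

namespace GromovBoundary

/-- The boundary point represented by a sequence converging at infinity. -/
def mk (x : ℕ → X) (hx : ConvergesAtInfinity x) : GromovBoundary X :=
  Quot.mk _ ⟨x, hx⟩

theorem exists_mk_eq (ξ : GromovBoundary X) : ∃ x hx, mk x hx = ξ := by
  obtain ⟨x, hx⟩ := ξ.exists_rep
  exact ⟨x.1, x.2, hx⟩

theorem mk_eq_mk_iff (hδ : IsDeltaHyperbolic X δ) {hx : ConvergesAtInfinity x}
    {hy : ConvergesAtInfinity y} : mk x hx = mk y hy ↔ GromovEquiv x y := by
  have hequiv : Equivalence fun x y : {u : ℕ → X // ConvergesAtInfinity u} =>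
      GromovEquiv x.1 y.1 := ⟨fun x => x.2, .symm, .trans hδ⟩
  exact ⟨fun h => hequiv.eqvGen_iff.1 (Quot.eqvGen_exact h), fun h => Quot.sound h⟩

end GromovBoundary

end Boundary

section Loxodromic

variable {G X : Type*} [Group G] [MetricSpace X] [MulAction G X] {δ : ℝ}

theorem IsEllipticElement.not_tendsto_dist_pow_smul {g : G} (hg : IsEllipticElement X g) (o : X) :
    ¬ Tendsto (fun n : ℕ => dist o (g ^ n • o)) atTop atTop := by
  intro h
  obtain ⟨R, hR⟩ := (Metric.isBounded_iff_subset_closedBall o).1 (hg o)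
  obtain ⟨n, hn⟩ := (h.eventually_gt_atTop R).exists
  have hmem : g ^ n • o ∈ Metric.closedBall o R := hR ⟨⟨g ^ n, Subgroup.npow_mem_zpowers g n⟩, rfl⟩
  rw [Metric.mem_closedBall, dist_comm] at hmem
  exact hn.not_ge hmem

variable [IsIsometricSMul G X]

theorem dist_inv_smul_self (g : G) (o : X) : dist o (g⁻¹ • o) = dist o (g • o) := by
  rw [← dist_smul g, smul_inv_smul, dist_comm]

theorem dist_inv_pow_smul_self (g : G) (o : X) (n : ℕ) :
    dist o (g⁻¹ ^ n • o) = dist o (g ^ n • o) := by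
  rw [inv_pow, dist_inv_smul_self]

theorem isHyperbolicElement_inv_iff {g : G} :
    IsHyperbolicElement X g⁻¹ ↔ IsHyperbolicElement X g := by
  have horbit (x : X) : MulAction.orbit (Subgroup.zpowers g⁻¹) x =
      MulAction.orbit (Subgroup.zpowers g) x := by rw [Subgroup.zpowers_inv]
  simp only [IsHyperbolicElement, IsEllipticElement, horbit, MulAction.fixedBy_inv]

theorem ConvergesAtInfinity.smul_mk_pow_smul {g : G} {o : X}
    (hg : ConvergesAtInfinity fun n : ℕ => g ^ n • o) :
    g • GromovBoundary.mk _ hg = GromovBoundary.mk _ hg := by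
  refine Quot.sound ?_
  simpa only [Function.comp_def, pow_succ', mul_smul, id]
    using GromovEquiv.comp_tendsto hg (tendsto_add_atTop_nat 1) tendsto_id

/-- By isometry `(gⁿo · gⁿw_j)_o = d(o, gⁿo) - (g⁻ⁿo · w_j)_o`, where the last term stays bounded
and `gⁿw ~ w`: positive powers of `g` push `o` towards `[w]`. -/
theorem IsDeltaHyperbolic.gromovEquiv_pow_smul (hδ : IsDeltaHyperbolic X δ) {g : G} {o : X}
    (hneg : ConvergesAtInfinity fun n : ℕ => g⁻¹ ^ n • o) {w : ℕ → X} (hw : ConvergesAtInfinity w)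
    (hgw : g • GromovBoundary.mk w hw = GromovBoundary.mk w hw)
    (hne : ¬ GromovEquiv (fun n : ℕ => g⁻¹ ^ n • o) w) :
    GromovEquiv (fun n : ℕ => g ^ n • o) w := by
  obtain ⟨K, hK⟩ := hδ.exists_eventually_gromovProduct_le o hneg hw hne
  have hfix (n : ℕ) : GromovEquiv (fun j => g ^ n • w j) w :=
    (GromovBoundary.mk_eq_mk_iff hδ).1 <|
      pow_mem (S := MulAction.stabilizer G (GromovBoundary.mk w hw)) hgw n
  have hdist := hneg.tendsto_dist o
  refine hδ.gromovEquiv_of_eventually_frequently o hw fun M => ?_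
  filter_upwards [hK, hdist.eventually_ge_atTop (M + δ + K)] with n hKn hn
  refine Eventually.frequently ?_
  filter_upwards [hKn, ((hfix n).tendsto_gromovProduct o).eventually_ge_atTop (M + δ)]
    with j hKj hj
  refine hδ.le_gromovProduct ?_ hj
  have hsum := gromovProduct_add_gromovProduct_left o (g⁻¹ ^ n • o) (w j)
  rw [gromovProduct_smul, ← inv_pow]
  linarith

theorem IsDeltaHyperbolic.isHyperbolicElement (hδ : IsDeltaHyperbolic X δ) {g : G} {o : X}
    (hpos : ConvergesAtInfinity fun n : ℕ => g ^ n • o)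
    (hneg : ConvergesAtInfinity fun n : ℕ => g⁻¹ ^ n • o)
    (hne : ¬ GromovEquiv (fun n : ℕ => g⁻¹ ^ n • o) fun n => g ^ n • o) :
    IsHyperbolicElement X g := by
  refine ⟨fun hell => hell.not_tendsto_dist_pow_smul o (hpos.tendsto_dist o), ?_⟩
  have hfixed : MulAction.fixedBy (GromovBoundary X) g = {.mk _ hneg, .mk _ hpos} := by
    refine Subset.antisymm (fun ζ hζ => ?_) (pair_subset ?_ hpos.smul_mk_pow_smul)
    · obtain ⟨w, hw, rfl⟩ := ζ.exists_mk_eq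
      refine or_iff_not_imp_left.2 fun hζneg => ((GromovBoundary.mk_eq_mk_iff hδ).2 ?_).symm
      exact hδ.gromovEquiv_pow_smul hneg hw hζ fun h =>
        hζneg ((GromovBoundary.mk_eq_mk_iff hδ).2 h.symm)
    · rw [← MulAction.fixedBy_inv]
      exact hneg.smul_mk_pow_smul
  rw [hfixed, encard_pair fun h => hne ((GromovBoundary.mk_eq_mk_iff hδ).1 h)]

theorem convergesAtInfinity_pow_smul {g : G} {o : X} {K : ℝ}
    (hg : Tendsto (fun n : ℕ => dist o (g ^ n • o)) atTop atTop)
    (hK : ∀ m n : ℕ, dist o (g ^ m • o) + dist o (g ^ n • o) ≤ dist o (g ^ (m + n) • o) + K) :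
    ConvergesAtInfinity fun n : ℕ => g ^ n • o := by
  refine convergesAtInfinity_of_le_gromovProduct_add o
    (tendsto_atTop_add_const_right _ (-(K / 2)) hg) fun n k => ?_
  have hdist : dist (g ^ n • o) (g ^ (n + k) • o) = dist o (g ^ k • o) := by
    rw [pow_add, mul_smul, dist_smul]
  unfold gromovProduct
  linarith [hK n k]

theorem IsDeltaHyperbolic.isHyperbolicElement_of_dist_add_dist_le (hδ : IsDeltaHyperbolic X δ)
    {g : G} {o : X} {K : ℝ} (hg : Tendsto (fun n : ℕ => dist o (g ^ n • o)) atTop atTop)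
    (hK : ∀ m n : ℕ, dist o (g ^ m • o) + dist o (g ^ n • o) ≤ dist o (g ^ (m + n) • o) + K) :
    IsHyperbolicElement X g := by
  refine hδ.isHyperbolicElement (convergesAtInfinity_pow_smul hg hK)
    (convergesAtInfinity_pow_smul (K := K) (by simpa only [dist_inv_pow_smul_self] using hg)
      (by simpa only [dist_inv_pow_smul_self] using hK)) fun h => ?_
  obtain ⟨n, hn⟩ := ((h.tendsto_gromovProduct o).eventually_gt_atTop (K / 2)).exists
  have hdist : dist (g⁻¹ ^ n • o) (g ^ n • o) = dist o (g ^ (n + n) • o) := by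
    rw [← dist_smul (g ^ n), inv_pow, smul_inv_smul, smul_smul, ← pow_add]
  have hadd := hK n n
  simp only [gromovProduct, hdist, dist_inv_pow_smul_self] at hn
  linarith

end Loxodromic

section Busemann

/-- `b` is a Busemann function of the boundary point `ξ` based at `o`, up to the error `C`: for
every sequence `w` converging to `ξ`, the differences `d(x, w_n) - d(o, w_n)` are eventually within
`C` of `b x`. In hyperbolic spaces these differences need not converge, hence the error. -/
def IsBusemann {X : Type*} [MetricSpace X] (ξ : GromovBoundary X) (o : X) (C : ℝ) (b : X → ℝ) :
    Prop :=
  ∀ (w : ℕ → X) (hw : ConvergesAtInfinity w), GromovBoundary.mk w hw = ξ →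
    ∀ x, ∀ᶠ n in atTop, |dist x (w n) - dist o (w n) - b x| ≤ C

variable {X : Type*} [MetricSpace X] {δ : ℝ}

theorem IsDeltaHyperbolic.abs_dist_sub_dist_sub_le (hδ : IsDeltaHyperbolic X δ) {o x y z : X}
    (h : dist o x ≤ gromovProduct o y z) :
    |dist x y - dist o y - (dist x z - dist o z)| ≤ 2 * δ := by
  have hy := gromovProduct_le_dist_left o x y
  have hz := gromovProduct_le_dist_left o x z
  have hxz := hδ.le_gromovProduct (o := o) (a := x) (b := y) (c := z)
    (M := gromovProduct o x y - δ) (by linarith) (by linarith)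
  have hxy := hδ.le_gromovProduct (o := o) (a := x) (b := z) (c := y)
    (M := gromovProduct o x z - δ) (by linarith) (by rw [gromovProduct_comm o z]; linarith)
  unfold gromovProduct at hxy hxz
  rw [abs_le]
  constructor <;> linarith

theorem IsDeltaHyperbolic.exists_isBusemann (hδ : IsDeltaHyperbolic X δ) (ξ : GromovBoundary X)
    (o : X) : ∃ b, IsBusemann ξ o (4 * δ) b := by
  obtain ⟨z, hz, rfl⟩ := ξ.exists_mk_eq
  choose N hN using fun x => ((gromovEquiv_iff_eventually o).1 hz (dist o x)).exists
  refine ⟨fun x => dist x (z (N x)) - dist o (z (N x)), fun w hw hwz x => ?_⟩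
  have hwz := (gromovEquiv_iff_eventually o).1 ((GromovBoundary.mk_eq_mk_iff hδ).1 hwz) (dist o x)
  filter_upwards [hwz] with n hn
  have hw := hδ.abs_dist_sub_dist_sub_le (hn n le_rfl (max n (N x)) (le_max_left _ _))
  have hz := hδ.abs_dist_sub_dist_sub_le (hN x (max n (N x)) (le_max_right _ _) (N x) le_rfl)
  rw [abs_le] at *
  constructor <;> linarith

namespace IsBusemann

variable {ξ : GromovBoundary X} {o : X} {C : ℝ} {b : X → ℝ}

theorem exists_forall_eventually (hb : IsBusemann ξ o C b) :
    ∃ z : ℕ → X, ∀ x, ∀ᶠ n in atTop, |dist x (z n) - dist o (z n) - b x| ≤ C :=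
  let ⟨z, hz, hzξ⟩ := ξ.exists_mk_eq
  ⟨z, hb z hz hzξ⟩

theorem abs_base_le (hb : IsBusemann ξ o C b) : |b o| ≤ C := by
  obtain ⟨z, hz⟩ := hb.exists_forall_eventually
  obtain ⟨n, hn⟩ := (hz o).exists
  simpa using hn

theorem abs_sub_le (hb : IsBusemann ξ o C b) (x y : X) : |b x - b y| ≤ dist x y + 2 * C := by
  obtain ⟨z, hz⟩ := hb.exists_forall_eventually
  obtain ⟨n, hx, hy⟩ := ((hz x).and (hz y)).exists
  have hxy := abs_dist_sub_le x y (z n)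
  rw [abs_le] at *
  constructor <;> linarith

theorem le_dist_add (hb : IsBusemann ξ o C b) (x : X) : b x ≤ dist o x + 3 * C := by
  rw [dist_comm]
  linarith [(abs_le.1 (hb.abs_sub_le x o)).2, (abs_le.1 hb.abs_base_le).2]

/-- The four-point condition with `ξ` as the fourth point. -/
theorem dist_add_le_max (hb : IsBusemann ξ o C b) (hδ : IsDeltaHyperbolic X δ) (x y w : X) :
    dist x y + b w ≤ max (dist x w + b y) (dist w y + b x) + (2 * δ + 2 * C) := by
  obtain ⟨z, hz⟩ := hb.exists_forall_eventually
  obtain ⟨n, ⟨hx, hy⟩, hw⟩ := (((hz x).and (hz y)).and (hz w)).exists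
  have hfour := hδ (z n) x w y
  simp only [gromovProduct, dist_comm (z n)] at hfour
  rw [abs_le] at hx hy hw
  rcases min_le_iff.1 hfour with h | h
  · linarith [le_max_left (dist x w + b y) (dist w y + b x)]
  · linarith [le_max_right (dist x w + b y) (dist w y + b x)]

theorem tendsto_atTop_of_ne (hb : IsBusemann ξ o C b) (hδ : IsDeltaHyperbolic X δ) {w : ℕ → X}
    (hw : ConvergesAtInfinity w) (hne : GromovBoundary.mk w hw ≠ ξ) :
    Tendsto (fun n => b (w n)) atTop atTop := by
  obtain ⟨z, hz, rfl⟩ := ξ.exists_mk_eq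
  obtain ⟨K, hK⟩ := hδ.exists_eventually_gromovProduct_le o hw hz fun h =>
    hne ((GromovBoundary.mk_eq_mk_iff hδ).2 h)
  refine tendsto_atTop_mono' _ ?_
    (tendsto_atTop_add_const_right _ (-(2 * K + C)) (hw.tendsto_dist o))
  filter_upwards [hK] with n hn
  obtain ⟨j, hjK, hj⟩ := (hn.and (hb z hz rfl (w n))).exists
  unfold gromovProduct at hjK
  linarith [(abs_le.1 hj).2]

variable {G : Type*} [Group G] [MulAction G X] [IsIsometricSMul G X]

theorem abs_smul_sub_le (hb : IsBusemann ξ o C b) {g : G} (hg : g ∈ MulAction.stabilizer G ξ)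
    (x : X) : |b (g • x) - b (g • o) - b x| ≤ 3 * C := by
  obtain ⟨z, hz, rfl⟩ := ξ.exists_mk_eq
  obtain ⟨n, ⟨hgx, hgo⟩, hx⟩ := (((hb z hz rfl (g • x)).and (hb z hz rfl (g • o))).and
    (hb _ (GromovEquiv.smul g⁻¹ hz) (inv_mem hg) x)).exists
  have hdist (y : X) : dist y (g⁻¹ • z n) = dist (g • y) (z n) := by
    rw [← dist_smul g y, smul_inv_smul]
  rw [hdist, hdist] at hx
  rw [abs_le] at *
  constructor <;> linarith

theorem isQuasimorphism (hb : IsBusemann ξ o C b) :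
    IsQuasimorphism (fun g : MulAction.stabilizer G ξ => b ((g : G) • o)) (3 * C) := fun g h => by
  simpa only [Subgroup.coe_mul, mul_smul] using hb.abs_smul_sub_le g.2 ((h : G) • o)

theorem exists_dist_pow_smul_le (hb : IsBusemann ξ o C b) (hδ : IsDeltaHyperbolic X δ) {g : G}
    (hg : g ∈ MulAction.stabilizer G ξ) (hlt : 3 * C + δ < b (g • o)) :
    ∃ K, ∀ n : ℕ, dist o (g ^ n • o) ≤ b (g ^ n • o) + K := by
  have hδ0 := hδ.nonneg o
  have hbo := abs_le.1 hb.abs_base_le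
  refine ⟨dist o (g • o) + 2 * δ + 2 * C, fun n => ?_⟩
  induction n with
  | zero =>
    rw [pow_zero, one_smul, dist_self]
    linarith [dist_nonneg (x := o) (y := g • o)]
  | succ n ih =>
    have hstep := (abs_le.1 (hb.abs_smul_sub_le hg (g ^ n • o))).1
    have hfour := hb.dist_add_le_max hδ o (g ^ (n + 1) • o) (g • o)
    rw [pow_succ', mul_smul, dist_smul] at *
    rcases max_cases (dist o (g • o) + b (g • g ^ n • o)) (dist o (g ^ n • o) + b o) with h | h
    · linarith
    · -- `dist o (g ^ n • o) - b (g ^ n • o)` does not increase from `n` to `n + 1`.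
      linarith

theorem isHyperbolicElement_of_lt (hb : IsBusemann ξ o C b) (hδ : IsDeltaHyperbolic X δ) {g : G}
    (hg : g ∈ MulAction.stabilizer G ξ) (hlt : 3 * C + δ < b (g • o)) :
    IsHyperbolicElement X g := by
  obtain ⟨K, hK⟩ := hb.exists_dist_pow_smul_le hδ hg hlt
  have hδ0 := hδ.nonneg o
  have hbtop : Tendsto (fun n : ℕ => b (g ^ n • o)) atTop atTop :=
    hb.isQuasimorphism.tendsto_map_pow_atTop (g := ⟨g, hg⟩) (by dsimp only; linarith)
  refine hδ.isHyperbolicElement_of_dist_add_dist_le (o := o) (K := 6 * C + 2 * K)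
    (tendsto_atTop_mono (fun n => ?_) (tendsto_atTop_add_const_right _ (-(3 * C)) hbtop))
    fun m n => ?_
  · linarith [hb.le_dist_add (g ^ n • o)]
  · have hmn := (abs_le.1 (hb.abs_smul_sub_le (pow_mem hg m) (g ^ n • o))).1
    rw [smul_smul, ← pow_add] at hmn
    linarith [hK m, hK n, hb.le_dist_add (g ^ (m + n) • o)]

theorem isHyperbolicElement_of_lt_abs (hb : IsBusemann ξ o C b) (hδ : IsDeltaHyperbolic X δ)
    {g : G} (hg : g ∈ MulAction.stabilizer G ξ) (hlt : 7 * C + δ < |b (g • o)|) :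
    IsHyperbolicElement X g := by
  have hbo := abs_le.1 hb.abs_base_le
  rcases lt_abs.1 hlt with hpos | hneg
  · exact hb.isHyperbolicElement_of_lt hδ hg (by linarith)
  · rw [← isHyperbolicElement_inv_iff]
    have hinv := (abs_le.1 (hb.abs_smul_sub_le hg (g⁻¹ • o))).2
    rw [smul_inv_smul] at hinv
    exact hb.isHyperbolicElement_of_lt hδ (inv_mem hg) (by linarith)

end IsBusemann

end Busemann

section LimitSet

theorem finiteIndex_stabilizer_of_finite_orbit {G α : Type*} [Group G] [MulAction G α] {a : α}
    (h : (MulAction.orbit G a).Finite) : (MulAction.stabilizer G a).FiniteIndex := by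
  refine ⟨?_⟩
  rw [MulAction.index_stabilizer]
  exact ((ncard_pos h).2 (MulAction.nonempty_orbit a)).ne'

variable {G X : Type*} [Group G] [MetricSpace X] [MulAction G X] [IsIsometricSMul G X]

theorem exists_forall_dist_smul_le_of_finiteIndex (H : Subgroup G) [H.FiniteIndex] (o o' : X) :
    ∃ R, ∀ g : G, ∃ h ∈ H, dist (g • o') (h • o) ≤ R := by
  obtain ⟨R, hR⟩ := Finite.exists_le fun q : G ⧸ H => dist (q.out⁻¹ • o') o
  refine ⟨R, fun g => ?_⟩
  set r := (QuotientGroup.mk g⁻¹ : G ⧸ H).out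
  refine ⟨g * r, ?_, ?_⟩
  · simpa using QuotientGroup.eq.1 (QuotientGroup.out_eq' (QuotientGroup.mk g⁻¹ : G ⧸ H)).symm
  · rw [mul_smul, dist_smul, ← dist_smul r⁻¹, inv_smul_smul]
    exact hR _

theorem smul_mem_limitSet (g : G) {ξ : GromovBoundary X} (hξ : ξ ∈ limitSet G X) :
    g • ξ ∈ limitSet G X := by
  obtain ⟨o, u, hu, rfl⟩ := hξ
  have hmul : (fun n => g • u n • o) = fun n => (g * u n) • o :=
    funext fun n => (mul_smul g (u n) o).symm
  refine ⟨o, fun n => g * u n, hmul ▸ GromovEquiv.smul g hu, ?_⟩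
  exact congrArg (Quot.mk _) (Subtype.ext hmul)

theorem IsLinealAction.exists_finite_orbit (h : IsLinealAction G X) :
    ∃ ξ : GromovBoundary X, (MulAction.orbit G ξ).Finite ∧ (limitSet G X \ {ξ}).Nonempty := by
  obtain ⟨ξ, η, hne, hlim⟩ := encard_eq_two.1 h
  have hξ : ξ ∈ limitSet G X := hlim ▸ mem_insert ξ {η}
  have hη : η ∈ limitSet G X := hlim ▸ mem_insert_of_mem ξ rfl
  refine ⟨ξ, (finite_of_encard_eq_coe h).subset ?_, η, hη, hne.symm⟩
  rintro _ ⟨g, rfl⟩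
  exact smul_mem_limitSet g hξ

theorem IsFocalAction.exists_finite_orbit (h : IsFocalAction G X) :
    ∃ ξ : GromovBoundary X, (MulAction.orbit G ξ).Finite ∧ (limitSet G X \ {ξ}).Nonempty := by
  obtain ⟨hinf, ξ, hξ⟩ := h
  exact ⟨ξ, (MulAction.subsingleton_orbit_iff_mem_fixedPoints.2 hξ).finite,
    (hinf.sdiff (finite_singleton ξ)).nonempty⟩

theorem IsBusemann.exists_lt_apply_smul {δ C : ℝ} {o : X} {b : X → ℝ} {ξ η : GromovBoundary X}
    (hb : IsBusemann ξ o C b) (hδ : IsDeltaHyperbolic X δ) (hη : η ∈ limitSet G X) (hne : η ≠ ξ)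
    (H : Subgroup G) [H.FiniteIndex] (M : ℝ) : ∃ h ∈ H, M < b (h • o) := by
  obtain ⟨o', u, hu, rfl⟩ := hη
  obtain ⟨R, hR⟩ := exists_forall_dist_smul_le_of_finiteIndex H o o'
  obtain ⟨n, hn⟩ := ((hb.tendsto_atTop_of_ne hδ hu hne).eventually_gt_atTop
    (M + R + 2 * C)).exists
  obtain ⟨h, hh, hdist⟩ := hR (u n)
  refine ⟨h, hh, ?_⟩
  linarith [(abs_le.1 (hb.abs_sub_le (u n • o') (h • o))).2]

theorem IsDeltaHyperbolic.exists_unbounded_isQuasimorphism {δ : ℝ} (hδ : IsDeltaHyperbolic X δ)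
    {ξ η : GromovBoundary X} (hη : η ∈ limitSet G X) (hne : η ≠ ξ) {H : Subgroup G} [H.FiniteIndex]
    (hH : H ≤ MulAction.stabilizer G ξ) :
    ∃ (β : H → ℝ) (D : ℝ), IsQuasimorphism β D ∧ (∀ M, ∃ h, M < |β h|) ∧
      ∀ h, D < |β h| → IsHyperbolicElement X (h : G) := by
  obtain ⟨z, -, -⟩ := ξ.exists_mk_eq
  obtain ⟨b, hb⟩ := hδ.exists_isBusemann ξ (z 0)
  have hδ0 := hδ.nonneg (z 0)
  refine ⟨_, 7 * (4 * δ) + δ,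
    (hb.isQuasimorphism.comp (Subgroup.inclusion hH)).mono (by linarith), fun M => ?_,
    fun h hlt => hb.isHyperbolicElement_of_lt_abs hδ (hH h.2) hlt⟩
  obtain ⟨h, hh, hM⟩ := hb.exists_lt_apply_smul hδ hη hne H M
  exact ⟨⟨h, hh⟩, hM.trans_le (le_abs_self _)⟩

end LimitSet

theorem mainTheorem7_general {G ι : Type*} [Group G] [Finite ι] (X : ι → Type*)
    [∀ i, MetricSpace (X i)] [∀ i, MulAction G (X i)] [∀ i, IsIsometricSMul G (X i)]
    (hX : ∀ i, ∃ δ, IsDeltaHyperbolic (X i) δ)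
    (hG : ∀ i, ∃ ξ : GromovBoundary (X i),
      (MulAction.orbit G ξ).Finite ∧ (limitSet G (X i) \ {ξ}).Nonempty) :
    (simultaneouslyHyperbolic G X).Nonempty := by
  choose δ hδ using hX
  choose ξ hfin η hη hne using hG
  let H : Subgroup G := ⨅ i, MulAction.stabilizer G (ξ i)
  have : H.FiniteIndex :=
    Subgroup.finiteIndex_iInf fun i => finiteIndex_stabilizer_of_finite_orbit (hfin i)
  choose β D hβ hunb hhyp using fun i =>
    (hδ i).exists_unbounded_isQuasimorphism (hη i) (hne i) (iInf_le _ i : H ≤ _)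
  obtain ⟨h, hh⟩ := IsQuasimorphism.exists_forall_lt_abs hβ hunb
  exact ⟨h, fun i => hhyp i h (hh i)⟩

theorem mainTheorem7 {G : Type*} [Group G] (l : ℕ) (X : Fin l → Type*)
    [∀ i, MetricSpace (X i)] [∀ i, MulAction G (X i)] [∀ i, IsIsometricSMul G (X i)]
    (hX : ∀ i, IsGromovHyperbolic (X i))
    (hG : ∀ i, IsLinealAction G (X i) ∨ IsFocalAction G (X i)) :
    (simultaneouslyHyperbolic G X).Nonempty :=
  mainTheorem7_general X (fun i => (hX i).exists_isDeltaHyperbolic) fun i =>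
    (hG i).elim (·.exists_finite_orbit) (·.exists_finite_orbit)
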